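/- Let $(G,u)$ be a unital $\ell$-group, i.e. a (not necessarily abelian) lattice-ordered group $G$, written additively, with a strong unit $u\ge 0$ (for every $g\in G$ there is $n\ge 1$ with $g\le nu$). Let $M=\Gamma(G,u)$ be the pseudo MV-algebra on the interval $[0,u]$ with $x\oplus y=(x+y)\wedge u$, $x^-=u-x$, $x^\sim=-x+u$, constants $0$ and $1=u$, and $x\odot y=(y^-\oplus x^-)^\sim=(x-u+y)\vee 0$. Suppose that $M$ is representable (a subdirect product of linearly ordered pseudo MV-algebras) and symmetric ($x^\sim=x^-$ for all $x\in M$). Let $r:M\to M$ be a square root, that is, for all $x,y\in M$: $r(x)\odot r(x)=x$; if $y\odot y\le x$ then $y\le r(x)$; and $r(x^-)=r(x)^-\oplus r(0)$, $r(x^\sim)=r(0)\oplus r(x)^\sim$. Put $w=r(0)^-\odot r(0)^-$. Then for every $x\in M$ the element $\frac{(x\wedge w^-)+w^-}{2}$ exists in $M$, and $$r(x)=(x\wedge w)\vee\frac{(x\wedge w^-)+w^-}{2}.$$ Here $+$ is the addition of $G$, and $z/2$ denotes the unique $h\in G$ with $h+h=z$. -/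

import Mathlib

namespace PMV

/-- The signature `(⊕, ⁻, ∼, 0, 1)` of pseudo MV-algebras: `oplus x y` is `x ⊕ y`,
`lneg x` is `x⁻` and `rneg x` is `x∼`. -/
class PseudoMVOps (M : Type*) extends Zero M, One M where
  /-- The sum `x ⊕ y`. -/
  oplus : M → M → M
  /-- The negation `x⁻`. -/
  lneg : M → M
  /-- The negation `x∼`. -/
  rneg : M → M

open PseudoMVOps

/-- The product `x ⊙ y = (y⁻ ⊕ x⁻)∼`. -/
def odot {M : Type*} [PseudoMVOps M] (x y : M) : M := rneg (oplus (lneg y) (lneg x))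

/-- Pseudo MV-algebras. -/
class PseudoMVAlgebra (M : Type*) extends PseudoMVOps M where
  oplus_assoc : ∀ x y z : M, oplus x (oplus y z) = oplus (oplus x y) z
  oplus_zero : ∀ x : M, oplus x 0 = x
  zero_oplus : ∀ x : M, oplus 0 x = x
  oplus_one : ∀ x : M, oplus x 1 = 1
  one_oplus : ∀ x : M, oplus 1 x = 1
  lneg_one : lneg (1 : M) = 0
  rneg_one : rneg (1 : M) = 0
  rneg_oplus_lneg : ∀ x y : M, rneg (oplus (lneg x) (lneg y)) = lneg (oplus (rneg x) (rneg y))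
  oplus_rneg_odot : ∀ x y : M, oplus x (odot (rneg x) y) = oplus y (odot (rneg y) x)
  oplus_rneg_odot' : ∀ x y : M, oplus y (odot (rneg y) x) = oplus (odot x (lneg y)) y
  odot_lneg_oplus : ∀ x y : M, oplus (odot x (lneg y)) y = oplus (odot y (lneg x)) x
  odot_oplus : ∀ x y : M, odot x (oplus (lneg x) y) = odot (oplus x (rneg y)) y
  rneg_lneg : ∀ x : M, rneg (lneg x) = x

/-- The lattice join `x ∨ y = x ⊕ (x∼ ⊙ y)`. -/
def join {M : Type*} [PseudoMVAlgebra M] (x y : M) : M := oplus x (odot (rneg x) y)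

/-- The lattice meet `x ∧ y = x ⊙ (x⁻ ⊕ y)`. -/
def meet {M : Type*} [PseudoMVAlgebra M] (x y : M) : M := odot x (oplus (lneg x) y)

/-- The lattice order: `x ≤ y` iff `x ∧ y = x`. -/
def Le {M : Type*} [PseudoMVAlgebra M] (x y : M) : Prop := meet x y = x

/-- `x → y = x⁻ ⊕ y`. -/
def limp {M : Type*} [PseudoMVAlgebra M] (x y : M) : M := oplus (lneg x) y

/-- `x ⇝ y = y ⊕ x∼`. -/
def rimp {M : Type*} [PseudoMVAlgebra M] (x y : M) : M := oplus y (rneg x)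

/-- `M` is linearly ordered. -/
def IsLinearlyOrdered (M : Type*) [PseudoMVAlgebra M] : Prop :=
  ∀ x y : M, Le x y ∨ Le y x

/-- `M` is symmetric: the two negations coincide. -/
def IsSymmetric (M : Type*) [PseudoMVAlgebra M] : Prop :=
  ∀ x : M, rneg x = lneg x

/-- Homomorphisms of pseudo MV-algebras. -/
structure IsHom {M N : Type*} [PseudoMVAlgebra M] [PseudoMVAlgebra N] (f : M → N) : Prop where
  map_zero : f 0 = 0
  map_one : f 1 = 1
  map_oplus : ∀ x y : M, f (oplus x y) = oplus (f x) (f y)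
  map_lneg : ∀ x : M, f (lneg x) = lneg (f x)
  map_rneg : ∀ x : M, f (rneg x) = rneg (f x)

/-- `M` is representable: it is a subdirect product of linearly ordered pseudo MV-algebras,
that is, it embeds into their direct product with surjective coordinate maps. (The factors are
then quotients of `M`, so that taking them in the universe of `M` is no restriction.) -/
def IsRepresentable.{v} (M : Type v) [PseudoMVAlgebra M] : Prop :=
  ∃ (ι : Type v) (N : ι → Type v) (_ : ∀ i, PseudoMVAlgebra (N i)) (f : ∀ i, M → N i),
    (∀ i, IsLinearlyOrdered (N i)) ∧ (∀ i, IsHom (f i)) ∧ (∀ i, Function.Surjective (f i)) ∧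
      ∀ x y : M, (∀ i, f i x = f i y) → x = y

/-- Square roots on a pseudo MV-algebra. -/
structure IsSquareRoot {M : Type*} [PseudoMVAlgebra M] (r : M → M) : Prop where
  sq : ∀ x : M, odot (r x) (r x) = x
  le_of_sq_le : ∀ x y : M, Le (odot y y) x → Le y (r x)
  map_lneg : ∀ x : M, r (lneg x) = limp (r x) (r 0)
  map_rneg : ∀ x : M, r (rneg x) = rimp (r x) (r 0)

section LGroup

variable {G : Type*} [Lattice G] [AddGroup G]

/-- `u` is a strong unit of the (not necessarily abelian) lattice-ordered group `G`. -/
structure IsStrongUnit (u : G) : Prop where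
  nonneg : 0 ≤ u
  exists_le_nsmul : ∀ g : G, ∃ n : ℕ, 1 ≤ n ∧ g ≤ n • u

/-- `y = z / 2` in the group `G`: `y` is the unique element with `y + y = z`. -/
def IsHalf (y z : G) : Prop := y + y = z ∧ ∀ y' : G, y' + y' = z → y' = y

/-- The underlying type of `Γ(G, u)`: the interval `[0, u]` of `G`. -/
@[ext]
structure Gamma (u : G) (hu : 0 ≤ u) where
  /-- The element of `G`. -/
  val : G
  nonneg : 0 ≤ val
  le_unit : val ≤ u

variable [AddLeftMono G] [AddRightMono G] {u : G} {hu : 0 ≤ u}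

/-- The operations of `Γ(G, u)`: `x ⊕ y = (x + y) ∧ u`, `x⁻ = u - x`, `x∼ = -x + u`. -/
instance : PseudoMVOps (Gamma u hu) where
  zero := ⟨0, le_rfl, hu⟩
  one := ⟨u, hu, le_rfl⟩
  oplus x y := ⟨(x.val + y.val) ⊓ u, le_inf (add_nonneg x.nonneg y.nonneg) hu, inf_le_right⟩
  lneg x := ⟨u - x.val, sub_nonneg.2 x.le_unit, sub_le_self u x.nonneg⟩
  rneg x := ⟨-x.val + u, le_neg_add_iff_add_le.2 (by simpa using x.le_unit),
    add_le_of_nonpos_left (neg_nonpos.2 x.nonneg)⟩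

theorem Gamma.val_zero : (0 : Gamma u hu).val = 0 := rfl

theorem Gamma.val_one : (1 : Gamma u hu).val = u := rfl

theorem Gamma.val_oplus (x y : Gamma u hu) : (oplus x y).val = (x.val + y.val) ⊓ u := rfl

theorem Gamma.val_lneg (x : Gamma u hu) : (lneg x).val = u - x.val := rfl

theorem Gamma.val_rneg (x : Gamma u hu) : (rneg x).val = -x.val + u := rfl

theorem Gamma.val_odot (x y : Gamma u hu) : (odot x y).val = (x.val - u + y.val) ⊔ 0 := by
  simp only [odot, val_rneg, val_oplus, val_lneg, neg_inf, sup_add, neg_add_cancel]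
  congr 1
  simp [sub_eq_add_neg, add_assoc]

theorem Gamma.val_join_aux (x y : Gamma u hu) :
    (oplus x (odot (rneg x) y)).val = x.val ⊔ y.val := by
  rw [val_oplus, val_odot, val_rneg, add_sup]
  have h : x.val + (-x.val + u - u + y.val) = y.val := by simp
  rw [h, add_zero, sup_comm, inf_eq_left]
  exact sup_le x.le_unit y.le_unit

theorem Gamma.val_join_aux' (x y : Gamma u hu) :
    (oplus (odot x (lneg y)) y).val = x.val ⊔ y.val := by
  rw [val_oplus, val_odot, val_lneg, sup_add]
  have h : x.val - u + (u - y.val) + y.val = x.val := by simp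
  rw [h, zero_add, inf_eq_left]
  exact sup_le x.le_unit y.le_unit

theorem Gamma.val_meet_aux (x y : Gamma u hu) :
    (odot x (oplus (lneg x) y)).val = x.val ⊓ y.val := by
  rw [val_odot, val_oplus, val_lneg, add_inf]
  have h : x.val - u + (u - x.val + y.val) = y.val := by simp [sub_eq_add_neg, add_assoc]
  rw [h, sub_add_cancel, inf_comm, sup_eq_left]
  exact le_inf x.nonneg y.nonneg

theorem Gamma.val_meet_aux' (x y : Gamma u hu) :
    (odot (oplus x (rneg y)) y).val = x.val ⊓ y.val := by
  rw [val_odot, val_oplus, val_rneg, inf_sub, inf_add]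
  have h : x.val + (-y.val + u) - u + y.val = x.val := by simp [sub_eq_add_neg, add_assoc]
  rw [h, sub_self, zero_add, sup_eq_left]
  exact le_inf x.nonneg y.nonneg

/-- `Γ(G, u)` is a pseudo MV-algebra. -/
instance : PseudoMVAlgebra (Gamma u hu) where
  oplus_assoc x y z := by
    ext
    simp only [Gamma.val_oplus, add_inf, inf_add, add_assoc]
    rw [inf_assoc, inf_assoc, inf_eq_right.2 (le_add_of_nonneg_left x.nonneg),
      inf_eq_right.2 (le_add_of_nonneg_right z.nonneg)]
  oplus_zero x := by
    ext; simp only [Gamma.val_oplus, Gamma.val_zero, add_zero]; exact inf_eq_left.2 x.le_unit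
  zero_oplus x := by
    ext; simp only [Gamma.val_oplus, Gamma.val_zero, zero_add]; exact inf_eq_left.2 x.le_unit
  oplus_one x := by
    ext; exact inf_eq_right.2 (le_add_of_nonneg_left x.nonneg)
  one_oplus x := by
    ext; exact inf_eq_right.2 (le_add_of_nonneg_right x.nonneg)
  lneg_one := by ext; exact sub_self u
  rneg_one := by ext; exact neg_add_cancel u
  rneg_oplus_lneg x y := by
    ext
    simp only [Gamma.val_rneg, Gamma.val_lneg, Gamma.val_oplus]
    rw [neg_inf, sup_add, sub_eq_add_neg u (_ ⊓ _), neg_inf, add_sup]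
    congr 1 <;> simp [sub_eq_add_neg, add_assoc]
  oplus_rneg_odot x y := by
    ext; rw [Gamma.val_join_aux, Gamma.val_join_aux, sup_comm]
  oplus_rneg_odot' x y := by
    ext; rw [Gamma.val_join_aux, Gamma.val_join_aux', sup_comm]
  odot_lneg_oplus x y := by
    ext; rw [Gamma.val_join_aux', Gamma.val_join_aux', sup_comm]
  odot_oplus x y := by
    ext; rw [Gamma.val_meet_aux, Gamma.val_meet_aux']
  rneg_lneg x := by
    ext; simp [Gamma.val_rneg, Gamma.val_lneg, sub_eq_add_neg]

/-- The lattice join of `Γ(G, u)` is that of `G`. -/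
theorem Gamma.val_join (x y : Gamma u hu) : (join x y).val = x.val ⊔ y.val :=
  Gamma.val_join_aux x y

/-- The lattice meet of `Γ(G, u)` is that of `G`. -/
theorem Gamma.val_meet (x y : Gamma u hu) : (meet x y).val = x.val ⊓ y.val :=
  Gamma.val_meet_aux x y

/-- The order of `Γ(G, u)` is that of `G`. -/
theorem Gamma.le_iff (x y : Gamma u hu) : Le x y ↔ x.val ≤ y.val := by
  rw [Le, Gamma.ext_iff, Gamma.val_meet, inf_eq_left]

end LGroup

end PMV

namespace PMV

open PseudoMVOps

section Hom

variable {M N : Type*} [PseudoMVAlgebra M] [PseudoMVAlgebra N] {f : M → N}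

/-! Equations in `M` are checked in the linearly ordered factors. Write `c = r 0`. In each factor
either the image of `w` is `0`, and then `r x ⊕ r x = 1` while `r x ⊙ r x = x`, so `r x` behaves as
`(x + u) / 2`; or the image of `c` is `0`, so that of `w` is `1`, and `r x` and `x` have the same
image (`map_weight_eq_zero_or`, `map_oplus_sqrt_self`, `map_sqrt_eq_self`). Hence `r x ∧ w⁻` is the
required half, and joining `x ∧ w` fills in the factors of the second kind.

The factors do not carry the addition of `G`. The bridge is `a + b = (a ⊙ b) + (a ⊕ b)`, valid since
symmetry makes `u` commute with `M`; uniqueness of halves comes from injectivity of doubling in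
chains (`isHalf_val`). As `r` need not descend to a factor, all statements concern images of
elements of `M`. -/

theorem IsHom.map_odot (hf : IsHom f) (x y : M) : f (odot x y) = odot (f x) (f y) := by
  simp only [odot, hf.map_rneg, hf.map_oplus, hf.map_lneg]

theorem IsHom.map_meet (hf : IsHom f) (x y : M) : f (meet x y) = meet (f x) (f y) := by
  simp only [meet, hf.map_odot, hf.map_oplus, hf.map_lneg]

theorem IsHom.map_join (hf : IsHom f) (x y : M) : f (join x y) = join (f x) (f y) := by
  simp only [join, hf.map_odot, hf.map_oplus, hf.map_rneg]

end Hom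

/-! ### Arithmetic of the interval and its symmetry -/

namespace Gamma

variable {G : Type*} [Lattice G] [AddGroup G] [AddLeftMono G] [AddRightMono G] {u : G}
  {hu : 0 ≤ u}

theorem meet_comm (x y : Gamma u hu) : meet x y = meet y x := by
  ext; simp only [val_meet, inf_comm]

theorem meet_eq_left {x y : Gamma u hu} (h : x.val ≤ y.val) : meet x y = x := (le_iff x y).2 h

theorem meet_one (x : Gamma u hu) : meet x 1 = x := meet_eq_left x.le_unit

theorem meet_zero (x : Gamma u hu) : meet x 0 = 0 := by
  rw [meet_comm]; exact meet_eq_left x.nonneg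

theorem zero_join (x : Gamma u hu) : join 0 x = x := by
  ext; rw [val_join, val_zero]; exact sup_eq_right.2 x.nonneg

theorem join_zero (x : Gamma u hu) : join x 0 = x := by
  ext; rw [val_join, val_zero]; exact sup_eq_left.2 x.nonneg

theorem odot_one (x : Gamma u hu) : odot x 1 = x := by
  ext; rw [val_odot, val_one, sub_add_cancel]; exact sup_eq_left.2 x.nonneg

theorem lneg_zero : lneg (0 : Gamma u hu) = 1 := by
  ext; rw [val_lneg, val_zero, val_one, sub_zero]

theorem oplus_mono {a b c d : Gamma u hu} (h : a.val ≤ b.val) (h' : c.val ≤ d.val) :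
    (oplus a c).val ≤ (oplus b d).val := by
  simp only [val_oplus]; exact inf_le_inf_right _ (add_le_add h h')

theorem le_oplus (a b : Gamma u hu) : a.val ≤ (oplus a b).val := by
  rw [val_oplus]; exact le_inf (le_add_of_nonneg_right b.nonneg) a.le_unit

theorem odot_le (a b : Gamma u hu) : (odot a b).val ≤ a.val := by
  rw [val_odot]
  refine sup_le ?_ a.nonneg
  rw [sub_eq_add_neg, add_assoc]
  refine add_le_of_nonpos_right ?_
  rw [neg_add_le_iff_le_add, add_zero]
  exact b.le_unit

theorem lneg_lneg (hsymm : IsSymmetric (Gamma u hu)) (x : Gamma u hu) : lneg (lneg x) = x := by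
  rw [← hsymm, PseudoMVAlgebra.rneg_lneg]

theorem lneg_odot (hsymm : IsSymmetric (Gamma u hu)) (x y : Gamma u hu) :
    lneg (odot x y) = oplus (lneg y) (lneg x) := by
  rw [odot, hsymm (oplus _ _), lneg_lneg hsymm]

theorem lneg_oplus (hsymm : IsSymmetric (Gamma u hu)) (x y : Gamma u hu) :
    lneg (oplus x y) = odot (lneg y) (lneg x) := by
  rw [odot, lneg_lneg hsymm, lneg_lneg hsymm, hsymm]

theorem val_add_unit (hsymm : IsSymmetric (Gamma u hu)) (x : Gamma u hu) :
    x.val + u = u + x.val := by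
  have h : -x.val + u = u - x.val := congrArg Gamma.val (hsymm x)
  rw [neg_add_eq_iff_eq_add, ← add_sub_assoc, eq_sub_iff_add_eq] at h
  exact h.symm

theorem val_odot_eq (hsymm : IsSymmetric (Gamma u hu)) (x y : Gamma u hu) :
    (odot x y).val = (x.val + y.val - u) ⊔ 0 := by
  have h : -u + y.val = y.val - u := by
    rw [neg_add_eq_iff_eq_add, ← add_sub_assoc, ← val_add_unit hsymm, add_sub_cancel_right]
  rw [val_odot, sub_eq_add_neg, add_assoc, h, add_sub_assoc]

theorem odot_lneg_self (x : Gamma u hu) : odot x (lneg x) = 0 := by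
  ext; rw [val_odot, val_lneg, val_zero]
  simp

/-- An element below its negation recovers a summand from a sum. -/
theorem lneg_odot_oplus (hsymm : IsSymmetric (Gamma u hu)) {a b : Gamma u hu}
    (h : b.val ≤ (lneg a).val) : odot (lneg a) (oplus a b) = b := by
  have h' : a.val + b.val ≤ u := by
    rw [← hsymm, val_rneg, le_neg_add_iff_add_le] at h; exact h
  ext
  rw [val_odot, val_oplus, inf_eq_left.2 h', ← hsymm, val_rneg]
  simp [sub_eq_add_neg, add_assoc, b.nonneg]

/-! ### Images in a linearly ordered algebra -/

section Chain

variable {N : Type*} [PseudoMVAlgebra N] {f : Gamma u hu → N}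

/-- Antisymmetry in the image, obtained by transporting commutativity of the meet from `Γ(G, u)`. -/
theorem map_le_antisymm (hf : IsHom f) {a b c d : Gamma u hu} (h : a.val ≤ b.val)
    (h' : c.val ≤ d.val) (hac : f a = f d) (hbc : f b = f c) : f a = f b := by
  have h1 := hf.map_meet a b
  have h2 := hf.map_meet c d
  have h3 := congrArg f (meet_comm b a)
  rw [meet_eq_left h] at h1
  rw [meet_eq_left h'] at h2
  rw [hf.map_meet, hf.map_meet] at h3
  rw [← hac, ← hbc] at h2
  exact h1.trans (h3.symm.trans h2.symm)

theorem map_eq_zero_of_le (hf : IsHom f) {a b : Gamma u hu} (h : a.val ≤ b.val) (hb : f b = 0) :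
    f a = 0 := by
  rw [← meet_eq_left h, hf.map_meet, hb, ← hf.map_zero, ← hf.map_meet, meet_zero]

theorem map_eq_one_of_le (hf : IsHom f) {a b : Gamma u hu} (h : a.val ≤ b.val) (ha : f a = 1) :
    f b = 1 := by
  have h1 := congrArg f (meet_eq_left h)
  rw [hf.map_meet, ha, ← hf.map_one, ← hf.map_meet, meet_comm, meet_one, hf.map_one] at h1
  exact h1

/-- The image of `a` is comparable with that of its negation, hence lies in the lower or the upper
half of the chain. -/
theorem map_odot_self_or_oplus_self (hsymm : IsSymmetric (Gamma u hu)) (hf : IsHom f)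
    (hN : IsLinearlyOrdered N) (a : Gamma u hu) : f (odot a a) = 0 ∨ f (oplus a a) = 1 := by
  have key : ∀ b : Gamma u hu, Le (f b) (f (lneg b)) → f (odot b b) = 0 := by
    intro b hb
    rw [Le, ← hf.map_meet] at hb
    rw [hf.map_odot]
    nth_rewrite 1 [← hb]
    rw [← hf.map_odot]
    refine (congrArg f ?_).trans hf.map_zero
    ext
    rw [val_odot, val_meet, val_lneg, val_zero]
    refine sup_eq_right.2 ?_
    calc b.val ⊓ (u - b.val) - u + b.val ≤ (u - b.val) - u + b.val := by
          gcongr; exact inf_le_right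
      _ = (rneg b).val - u + b.val := by rw [hsymm, val_lneg]
      _ = 0 := by simp [val_rneg, sub_eq_add_neg, add_assoc]
  rcases hN (f a) (f (lneg a)) with h | h
  · exact Or.inl (key a h)
  · right
    have h1 := key (lneg a) (by rwa [lneg_lneg hsymm])
    rw [← lneg_lneg hsymm (oplus a a), lneg_oplus hsymm, hf.map_lneg, h1, ← hf.map_zero,
      ← hf.map_lneg, lneg_zero, hf.map_one]

/-- Doubling is injective on the lower half of a linearly ordered image. -/
theorem map_eq_of_oplus_self (hsymm : IsSymmetric (Gamma u hu)) (hf : IsHom f)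
    (hN : IsLinearlyOrdered N) {a b : Gamma u hu} (ha : f (odot a a) = 0) (hb : f (odot b b) = 0)
    (h : f (oplus a a) = f (oplus b b)) : f a = f b := by
  -- Replacing `c` by `c ∧ c⁻` keeps its image and makes it lie below its negation in `M` itself.
  have small : ∀ c : Gamma u hu, f (odot c c) = 0 → f (meet c (lneg c)) = f c := by
    intro c hc
    rw [meet, ← lneg_odot hsymm, hf.map_odot, hf.map_lneg, hc, ← hf.map_zero, ← hf.map_lneg,
      ← hf.map_odot, lneg_zero, odot_one]
  have main : ∀ a b : Gamma u hu, b.val ≤ (lneg b).val → Le (f a) (f b) →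
      f (oplus a a) = f (oplus b b) → f a = f b := by
    intro a b hb hab h
    rw [Le, ← hf.map_meet] at hab
    have hle : (meet a b).val ≤ b.val := by rw [val_meet]; exact inf_le_right
    generalize meet a b = c at hab hle
    rw [hf.map_oplus, ← hab, ← hf.map_oplus] at h
    rw [← hab]
    have hcb : b.val ≤ (lneg c).val := hb.trans (by simp only [val_lneg]; gcongr)
    -- The chain `c ⊕ c ≤ c ⊕ b ≤ b ⊕ b` has ends with equal images, so it collapses; then `c` is
    -- cancelled from `c ⊕ c` and `c ⊕ b`.
    have e := map_le_antisymm hf (oplus_mono le_rfl hle) (oplus_mono hle le_rfl) h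
      (b := oplus c b) (c := oplus c b) rfl
    rw [← lneg_odot_oplus hsymm (hle.trans hcb), hf.map_odot, e, ← hf.map_odot,
      lneg_odot_oplus hsymm hcb]
  have le_neg : ∀ c : Gamma u hu,
      (meet c (lneg c)).val ≤ (lneg (meet c (lneg c))).val := by
    intro c
    rw [val_lneg, val_meet]
    calc _ ≤ (lneg c).val := inf_le_right
      _ ≤ _ := by rw [val_lneg]; gcongr; exact inf_le_left
  rcases hN (f a) (f b) with hab | hab
  · rw [← small b hb] at hab ⊢
    exact main _ _ (le_neg b) hab (by rw [h, hf.map_oplus, hf.map_oplus, small b hb])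
  · rw [← small a ha] at hab ⊢
    exact (main _ _ (le_neg a) hab (by rw [← h, hf.map_oplus, hf.map_oplus, small a ha])).symm

/-- Dual of the lower half under negation. -/
theorem map_eq_of_odot_self (hsymm : IsSymmetric (Gamma u hu)) (hf : IsHom f)
    (hN : IsLinearlyOrdered N) {a b : Gamma u hu} (ha : f (oplus a a) = 1)
    (hb : f (oplus b b) = 1) (h : f (odot a a) = f (odot b b)) : f a = f b := by
  have h0 : f (lneg 1) = 0 := by rw [PseudoMVAlgebra.lneg_one, hf.map_zero]
  rw [hf.map_lneg, hf.map_one] at h0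
  have := map_eq_of_oplus_self hsymm hf hN (a := lneg a) (b := lneg b)
    (by rw [← lneg_oplus hsymm, hf.map_lneg, ha, h0])
    (by rw [← lneg_oplus hsymm, hf.map_lneg, hb, h0])
    (by rw [← lneg_odot hsymm, ← lneg_odot hsymm, hf.map_lneg, hf.map_lneg, h])
  rw [← lneg_lneg hsymm a, ← lneg_lneg hsymm b, hf.map_lneg, this, ← hf.map_lneg]

theorem map_eq_of_double_eq (hsymm : IsSymmetric (Gamma u hu)) (hf : IsHom f)
    (hN : IsLinearlyOrdered N) {a b : Gamma u hu} (h : f (odot a a) = f (odot b b))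
    (h' : f (oplus a a) = f (oplus b b)) : f a = f b := by
  rcases map_odot_self_or_oplus_self hsymm hf hN a with ha | ha
  · exact map_eq_of_oplus_self hsymm hf hN ha (h ▸ ha) h'
  · exact map_eq_of_odot_self hsymm hf hN ha (h' ▸ ha) h

/-! ### Square roots in a linearly ordered image -/

variable {r : Gamma u hu → Gamma u hu}

/-- In a linearly ordered image, a square root is either strict or the identity. -/
theorem map_weight_eq_zero_or (hsymm : IsSymmetric (Gamma u hu)) (hr : IsSquareRoot r)
    (hf : IsHom f) (hN : IsLinearlyOrdered N) :
    f (odot (lneg (r 0)) (lneg (r 0))) = 0 ∨ f (r 0) = 0 := by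
  set c := r 0 with hc
  set w := odot (lneg c) (lneg c) with hw
  have hcw : lneg w = oplus c c := by rw [hw, lneg_odot hsymm, lneg_lneg hsymm]
  rcases map_odot_self_or_oplus_self hsymm hf hN (r w) with h | h
  · left; rwa [hr.sq] at h
  -- Both are in the upper half and have square `w`.
  have hs : f (r w) = f (lneg c) := by
    refine map_eq_of_odot_self hsymm hf hN h ?_ (by rw [hr.sq])
    rw [← lneg_odot hsymm, hc, hr.sq, lneg_zero, hf.map_one]
  have hsq := hr.sq (lneg w)
  rw [hr.map_lneg, limp, hcw, ← hc] at hsq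
  -- So `r (w⁻)` has the image of `c ⊕ c = w⁻`, which is therefore idempotent, and in a chain equals
  -- `0` or `1`.
  have ht : f (odot (oplus c c) (oplus c c)) = f (oplus c c) := by
    refine Eq.trans ?_ (congrArg f hsq)
    simp only [hf.map_odot, hf.map_oplus, hf.map_lneg, hs]
    simp only [← hf.map_lneg, lneg_lneg hsymm]
  have hmeet : f (meet (oplus c c) (lneg (oplus c c))) = 0 := by
    rw [meet, ← lneg_odot hsymm, hf.map_odot, hf.map_lneg, ht, ← hf.map_lneg, ← hf.map_odot,
      odot_lneg_self, hf.map_zero]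
  have hmeet' := hmeet
  rw [meet_comm] at hmeet'
  rw [hf.map_meet] at hmeet hmeet'
  rcases hN (f (oplus c c)) (f (lneg (oplus c c))) with h1 | h1 <;> rw [Le] at h1
  · exact Or.inr (map_eq_zero_of_le hf (le_oplus c c) (h1.symm.trans hmeet))
  · left
    rw [← lneg_lneg hsymm w, hcw]
    exact h1.symm.trans hmeet'

theorem val_sqrt_zero_le (hr : IsSquareRoot r) (x : Gamma u hu) : (r 0).val ≤ (r x).val := by
  refine (le_iff _ _).1 (hr.le_of_sq_le x (r 0) ?_)
  rw [hr.sq, le_iff]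
  exact x.nonneg

theorem map_oplus_sqrt_self (hsymm : IsSymmetric (Gamma u hu)) (hr : IsSquareRoot r)
    (hf : IsHom f) (hw : f (odot (lneg (r 0)) (lneg (r 0))) = 0) (x : Gamma u hu) :
    f (oplus (r x) (r x)) = 1 := by
  refine map_eq_one_of_le hf
    (oplus_mono (val_sqrt_zero_le hr x) (val_sqrt_zero_le hr x)) ?_
  rw [← lneg_lneg hsymm (oplus (r 0) (r 0)), lneg_oplus hsymm, hf.map_lneg, hw, ← hf.map_zero,
    ← hf.map_lneg, lneg_zero, hf.map_one]

theorem map_sqrt_eq_self (hsymm : IsSymmetric (Gamma u hu)) (hr : IsSquareRoot r)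
    (hf : IsHom f) (hN : IsLinearlyOrdered N) (h0 : f (r 0) = 0) (x : Gamma u hu) :
    f (r x) = f x := by
  have hneg : f (r (lneg x)) = f (lneg (r x)) := by
    rw [hr.map_lneg, limp, hf.map_oplus, h0, PseudoMVAlgebra.oplus_zero]
  -- Negate `r (x⁻) ⊙ r (x⁻) = x⁻`. Thus `r x ⊙ r x` and `r x ⊕ r x` both have the image of `x`,
  -- which must be `0` or `1`.
  have hx : f (oplus (r x) (r x)) = f x := by
    rw [← lneg_lneg hsymm (oplus (r x) (r x)), lneg_oplus hsymm, hf.map_lneg, hf.map_odot, ← hneg,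
      ← hf.map_odot, hr.sq, ← hf.map_lneg, lneg_lneg hsymm]
  rcases map_odot_self_or_oplus_self hsymm hf hN (r x) with h | h
  · rw [hr.sq] at h
    rw [h]
    exact map_eq_zero_of_le hf (le_oplus _ _) (hx.trans h)
  · rw [hx] at h
    rw [h]
    exact map_eq_one_of_le hf (odot_le (r x) (r x)) (by rw [hr.sq, h])

end Chain

/-- A sum in `G` of two elements of `Γ(G, u)` is determined by their sum and product. -/
theorem val_add_eq_of_oplus_of_odot (hsymm : IsSymmetric (Gamma u hu)) {a b c d : Gamma u hu}
    (h : oplus a b = oplus c d) (h' : odot a b = odot c d) :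
    a.val + b.val = c.val + d.val := by
  have key : ∀ x y : Gamma u hu, (odot x y).val + (oplus x y).val = x.val + y.val := by
    intro x y
    rw [val_odot_eq hsymm, val_oplus]
    have h2 : (x.val + y.val - u) ⊔ 0 = (x.val + y.val) - ((x.val + y.val) ⊓ u) := by
      rw [sub_eq_add_neg _ (_ ⊓ _), neg_inf, add_sup, add_neg_cancel, sup_comm, sub_eq_add_neg,
        sup_comm]
    rw [h2, sub_add_cancel]
  rw [← key a b, ← key c d, h, h']

theorem oplus_eq_and_odot_eq_of_val_add (hsymm : IsSymmetric (Gamma u hu)) {a b : Gamma u hu}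
    (h : a.val + a.val = b.val + b.val) : oplus a a = oplus b b ∧ odot a a = odot b b := by
  have h1 : oplus a a = oplus b b := by ext; rw [val_oplus, val_oplus, h]
  refine ⟨h1, ?_⟩
  ext; rw [val_odot_eq hsymm, val_odot_eq hsymm, h]

end Gamma

/-! ### Existence and uniqueness of halves in the group -/

section Halves

variable {G : Type*} [Lattice G] [AddGroup G] [AddLeftMono G] [AddRightMono G] {u : G}
  {hu : 0 ≤ u}

/-- The element `y ⊓ 0` is idempotent under addition, hence `0`. -/
theorem nonneg_of_add_self_nonneg {y : G} (h : 0 ≤ y + y) : 0 ≤ y := by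
  have h1 : y ⊓ 0 + y ⊓ 0 = y ⊓ 0 := by
    rw [add_inf, inf_add, inf_add, add_zero, zero_add, add_zero]
    have : (y + y) ⊓ y ⊓ (y ⊓ 0) = y ⊓ 0 :=
      inf_eq_right.2 (le_inf (inf_le_right.trans h) inf_le_left)
    exact this
  have h2 : y ⊓ 0 = 0 := by simpa using h1
  exact inf_eq_right.1 h2

theorem mem_Icc_of_add_self_le (hsymm : IsSymmetric (Gamma u hu)) {y : G} (h0 : 0 ≤ y + y)
    (h : y + y ≤ u + u) : 0 ≤ y ∧ y ≤ u := by
  have hy := nonneg_of_add_self_nonneg h0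
  refine ⟨hy, ?_⟩
  have hle : y ≤ u + u := (le_add_of_nonneg_right hy).trans h
  have e1 := Gamma.val_add_unit hsymm (⟨y ⊓ u, le_inf hy hu, inf_le_right⟩ : Gamma u hu)
  have e2 := Gamma.val_add_unit hsymm
    (⟨(y - u) ⊔ 0, le_sup_right, sup_le (sub_le_iff_le_add.2 hle) hu⟩ : Gamma u hu)
  -- Both summands lie in `[0, u]`, so they commute with `u`, and so does `y`; this gives `2(u - y)
  -- = 2u - 2y`.
  have hsum : (y - u) ⊔ 0 + y ⊓ u = y := by
    have : (y - u) ⊔ 0 = y - y ⊓ u := by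
      rw [sub_eq_add_neg _ (_ ⊓ _), neg_inf, add_sup, add_neg_cancel, sup_comm, sub_eq_add_neg,
        sup_comm]
    rw [this, sub_add_cancel]
  have comm : y + u = u + y := by
    rw [← hsum, add_assoc, e1, ← add_assoc, e2, add_assoc]
  rw [← sub_nonneg]
  apply nonneg_of_add_self_nonneg
  have e : u - y + (u - y) = u + u - (y + y) := by
    have : -y + u = u - y := by
      rw [neg_add_eq_iff_eq_add, ← add_sub_assoc, comm, add_sub_cancel_right]
    rw [sub_eq_add_neg, add_assoc, ← add_assoc (-y), this]
    simp [sub_eq_add_neg, add_assoc]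
  rw [e, sub_nonneg]
  exact h

/-- Any competing half is forced into `[0, u]`, where it has the same `⊕`- and `⊙`-doubles as `h`,
hence the same image in every factor. -/
theorem isHalf_val (hsymm : IsSymmetric (Gamma u hu)) (hrep : IsRepresentable (Gamma u hu))
    {h a b : Gamma u hu} (hs : oplus h h = oplus a b) (hp : odot h h = odot a b) :
    IsHalf h.val (a.val + b.val) := by
  have hsum := Gamma.val_add_eq_of_oplus_of_odot hsymm hs hp
  refine ⟨hsum, fun y hy => ?_⟩
  rw [← hsum] at hy
  obtain ⟨h0, h1⟩ := mem_Icc_of_add_self_le hsymm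
    (hy ▸ add_nonneg h.nonneg h.nonneg) (hy ▸ add_le_add h.le_unit h.le_unit)
  obtain ⟨e1, e2⟩ := Gamma.oplus_eq_and_odot_eq_of_val_add hsymm
    (a := ⟨y, h0, h1⟩) (b := h) hy
  obtain ⟨ι, N, _, f, hN, hf, -, hinj⟩ := hrep
  exact congrArg Gamma.val (hinj ⟨y, h0, h1⟩ h fun i =>
    Gamma.map_eq_of_double_eq hsymm (hf i) (hN i) (congrArg _ e2) (congrArg _ e1))

end Halves

end PMV

open PMV PMV.PseudoMVOps in
theorem theorem7p3 {G : Type*} [Lattice G] [AddGroup G] [AddLeftMono G] [AddRightMono G]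
    (u : G) (hu : IsStrongUnit u)
    (hrep : IsRepresentable (Gamma u hu.nonneg)) (hsymm : IsSymmetric (Gamma u hu.nonneg))
    (r : Gamma u hu.nonneg → Gamma u hu.nonneg) (hr : IsSquareRoot r)
    (w : Gamma u hu.nonneg) (hw : w = odot (lneg (r 0)) (lneg (r 0))) :
    ∀ x : Gamma u hu.nonneg, ∃ h : Gamma u hu.nonneg,
      IsHalf h.val ((meet x (lneg w)).val + (lneg w).val) ∧ r x = join (meet x w) h := by
  intro x
  have hrep' := hrep
  obtain ⟨ι, N, _, f, hN, hf, -, hinj⟩ := hrep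
  have cases : ∀ i, (f i w = f i 0 ∧ f i (lneg w) = f i 1 ∧ f i (oplus (r x) (r x)) = f i 1) ∨
      (f i w = f i 1 ∧ f i (lneg w) = f i 0 ∧ f i (r x) = f i x) := by
    intro i
    rcases Gamma.map_weight_eq_zero_or hsymm hr (hf i) (hN i) with h | h
    · refine Or.inl ⟨?_, ?_, ?_⟩
      · rw [hw, h, (hf i).map_zero]
      · rw [(hf i).map_lneg, hw, h, ← (hf i).map_zero, ← (hf i).map_lneg, Gamma.lneg_zero]
      · rw [Gamma.map_oplus_sqrt_self hsymm hr (hf i) h, (hf i).map_one]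
    · have hc : f i (lneg w) = f i 0 := by
        rw [hw, Gamma.lneg_odot hsymm, Gamma.lneg_lneg hsymm, (hf i).map_oplus, h,
          PseudoMVAlgebra.oplus_zero, (hf i).map_zero]
      refine Or.inr ⟨?_, hc, Gamma.map_sqrt_eq_self hsymm hr (hf i) (hN i) h x⟩
      rw [← Gamma.lneg_lneg hsymm w, (hf i).map_lneg, hc, ← (hf i).map_lneg, Gamma.lneg_zero]
  -- Meeting with `w⁻` keeps `r x` where `w` maps to `0` and kills it where `w` maps to `1`.
  refine ⟨meet (r x) (lneg w), isHalf_val hsymm hrep' ?_ ?_, ?_⟩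
  · refine hinj _ _ fun i => ?_
    rcases cases i with ⟨-, h, hx⟩ | ⟨-, h, -⟩
    · simp only [(hf i).map_oplus, (hf i).map_meet, h]
      simp only [← (hf i).map_oplus, ← (hf i).map_meet, Gamma.meet_one, hx,
        PseudoMVAlgebra.oplus_one]
    · simp only [(hf i).map_oplus, (hf i).map_meet, h]
      simp only [← (hf i).map_oplus, ← (hf i).map_meet, Gamma.meet_zero]
  · refine hinj _ _ fun i => ?_
    rcases cases i with ⟨-, h, -⟩ | ⟨-, h, -⟩
    · simp only [(hf i).map_odot, (hf i).map_meet, h]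
      simp only [← (hf i).map_odot, ← (hf i).map_meet, Gamma.meet_one, Gamma.odot_one, hr.sq]
    · simp only [(hf i).map_odot, (hf i).map_meet, h]
      simp only [← (hf i).map_odot, ← (hf i).map_meet, Gamma.meet_zero]
  · refine hinj _ _ fun i => ?_
    rcases cases i with ⟨h', h, -⟩ | ⟨h', h, hx⟩
    · simp only [(hf i).map_join, (hf i).map_meet, h, h']
      simp only [← (hf i).map_join, ← (hf i).map_meet, Gamma.meet_zero, Gamma.meet_one,
        Gamma.zero_join]
    · simp only [(hf i).map_join, (hf i).map_meet, h, h']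
      simp only [← (hf i).map_join, ← (hf i).map_meet, Gamma.meet_zero, Gamma.meet_one,
        Gamma.join_zero, hx]
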